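/- Let $s$ be an integer, let $K>0$ and $0<\varepsilon<2^{-10}$ be real numbers with $32\varepsilon Ks\ge 1$, and let $A,B\subset\mathbb{Z}$ be finite sets with $$(1-\varepsilon)\frac{Ks}{2}\le |B|\le (1+2\varepsilon)\frac{Ks}{2}\qquad\text{and}\qquad |A|\le Ks .$$ Then at least one of the following holds: (a) there are at least $4\varepsilon^2K^2s^2$ ordered pairs $(b_1,b_2)\in B^2$ (with $b_1=b_2$ allowed) such that $b_1+b_2\notin A$; (b) there is a finite arithmetic progression $P\subset\mathbb{Z}$ of size at most $\frac{Ks}{2}+32\varepsilon Ks$ such that $|B\setminus P|\le 8\varepsilon Ks$. -/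

import Mathlib

/-- A finite arithmetic progression of integers: `{a, a + d, …, a + (n - 1) d}` with common
difference `d > 0`. Since `d ≠ 0`, the number of terms `n` is the cardinality of `P`. -/
def IsFiniteArithProg (P : Finset ℤ) : Prop :=
  ∃ (a d : ℤ) (n : ℕ), 0 < d ∧ P = (Finset.range n).image (fun i : ℕ => a + (i : ℤ) * d)

/-- The set of ordered pairs `(b₁, b₂) ∈ B²` with `b₁ + b₂ ∉ A`. -/
def pairsWithSumOutside (A B : Finset ℤ) : Finset (ℤ × ℤ) :=
  (B ×ˢ B).filter (fun p => p.1 + p.2 ∉ A)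

/-! Put N = Ks and β = 2εN, so that failure of (a) means fewer than β² bad pairs. Discarding the at
most β elements with more than β bad partners leaves C ⊆ B in which each element has at most k = ⌊β⌋
bad partners. Reduce modulo m = max C − min C. The image X has |C| − 1 elements, and the image S of
A is small because sums with min C and with max C coincide modulo m. All translates u + X lie in S
up to k elements, so any two share at least r = 3|C| − 2 − 4k − |A| points. Hence the differences of
X form a subgroup H with r|H| ≤ |X|², and C lies in a progression of |H| + 1 terms. Since r and |X|
are both N/2 + O(β), so is |H|. -/

/-- If every difference of two elements of `X` is a difference in at least `r > |X| / 2` ways, then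
the differences of `X` form a subgroup `H`, and counting pairs in `X` gives `r |H| ≤ |X|²`. -/
theorem exists_addSubgroup_of_popular_differences {G : Type*} [AddCommGroup G] [DecidableEq G]
    (X : Finset G) (hX : X.Nonempty) (r : ℕ) (hr : X.card < 2 * r)
    (h : ∀ u ∈ X, ∀ w ∈ X, r ≤ (X.filter (fun v => v + (u - w) ∈ X)).card) :
    ∃ H : AddSubgroup G, (∀ u ∈ X, ∀ w ∈ X, u - w ∈ H) ∧ Nat.card H * r ≤ X.card ^ 2 := by
  let D : Finset G := (X ×ˢ X).image (fun p => p.1 - p.2)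
  have hD : ∀ d, d ∈ D ↔ ∃ u ∈ X, ∃ w ∈ X, u - w = d := by
    intro d
    simp only [D, Finset.mem_image, Finset.mem_product, Prod.exists]
    constructor
    · rintro ⟨u, w, ⟨hu, hw⟩, rfl⟩
      exact ⟨u, hu, w, hw, rfl⟩
    · rintro ⟨u, hu, w, hw, rfl⟩
      exact ⟨u, w, ⟨hu, hw⟩, rfl⟩
  have hneg : ∀ d ∈ D, -d ∈ D := by
    intro d hd
    obtain ⟨u, hu, w, hw, rfl⟩ := (hD d).1 hd
    exact (hD _).2 ⟨w, hw, u, hu, by abel⟩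
  have hpop : ∀ d ∈ D, r ≤ (X.filter (fun v => v + d ∈ X)).card := by
    intro d hd
    obtain ⟨u, hu, w, hw, rfl⟩ := (hD d).1 hd
    exact h u hu w hw
  have hadd : ∀ d ∈ D, ∀ e ∈ D, d + e ∈ D := by
    intro d hd e he
    have h1 := hpop d hd
    have h2 := hpop (-e) (hneg e he)
    have hlt : X.card < (X.filter (fun v => v + d ∈ X)).card +
        (X.filter (fun v => v + -e ∈ X)).card := by omega
    -- As 2r > |X|, some v has both v + d and v − e in X; these two differ by d + e.
    obtain ⟨v, hv⟩ := Finset.inter_nonempty_of_card_lt_card_add_card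
      (Finset.filter_subset _ _) (Finset.filter_subset _ _) hlt
    simp only [Finset.mem_inter, Finset.mem_filter] at hv
    exact (hD _).2 ⟨v + d, hv.1.2, v + -e, hv.2.2, by abel⟩
  obtain ⟨x, hx⟩ := hX
  let H : AddSubgroup G :=
    { carrier := D
      zero_mem' := (hD 0).2 ⟨x, hx, x, hx, sub_self x⟩
      add_mem' := fun {a b} ha hb => hadd a ha b hb
      neg_mem' := fun {a} ha => hneg a ha }
  refine ⟨H, fun u hu w hw => (hD _).2 ⟨u, hu, w, hw, rfl⟩, ?_⟩
  have hcard : Nat.card H = D.card := by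
    change Nat.card (D : Set G) = D.card
    simp
  have hfib : ∀ d ∈ D, r ≤ ((X ×ˢ X).filter (fun p => p.1 - p.2 = d)).card := by
    intro d hd
    refine (hpop d hd).trans ?_
    refine Finset.card_le_card_of_injOn (fun v => (v + d, v)) ?_ ?_
    · intro v hv
      simp only [Finset.coe_filter, Set.mem_ofPred_eq] at hv
      simp [hv.1, hv.2]
    · intro v _ w _ hvw
      exact (Prod.ext_iff.1 hvw).2
  have hsum := Finset.card_eq_sum_card_image (fun p : G × G => p.1 - p.2) (X ×ˢ X)
  rw [Finset.card_product] at hsum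
  rw [hcard, sq, hsum]
  simpa using Finset.card_nsmul_le_sum D _ r hfib

/-- A finite set of integers lying in a subgroup of order `h` modulo `m` and in `[a, a + m]`
after translating by `a` lies in an arithmetic progression of size `h + 1`. -/
theorem exists_arithProg_of_sub_mem_addSubgroup {m : ℕ} (hm : 0 < m) (H : AddSubgroup (ZMod m))
    (B : Finset ℤ) (a : ℤ) (hB : ∀ b ∈ B, a ≤ b ∧ b ≤ a + m)
    (hH : ∀ b ∈ B, ((b - a : ℤ) : ZMod m) ∈ H) :
    ∃ P : Finset ℤ, IsFiniteArithProg P ∧ P.card ≤ Nat.card H + 1 ∧ B ⊆ P := by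
  have : NeZero m := ⟨hm.ne'⟩
  obtain ⟨q, hq⟩ : Nat.card H ∣ m := by
    simpa using H.card_addSubgroup_dvd_card
  have hpos : 0 < Nat.card H := Nat.card_pos
  have hq0 : 0 < q := Nat.pos_of_ne_zero (by rintro rfl; omega)
  refine ⟨_, ⟨a, q, Nat.card H + 1, by exact_mod_cast hq0, rfl⟩, ?_, ?_⟩
  · exact Finset.card_image_le.trans (by simp)
  · intro b hb
    -- The order of H kills H, so q = m / |H| divides b − a; a closed interval of length m holds |H|
    -- + 1 such points.
    have hz : Nat.card H • ((b - a : ℤ) : ZMod m) = 0 := by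
      have h1 : Nat.card H • (⟨_, hH b hb⟩ : H) = 0 := card_nsmul_eq_zero'
      exact congrArg Subtype.val h1
    have hdvd : (m : ℤ) ∣ (Nat.card H : ℤ) * (b - a) := by
      rw [← ZMod.intCast_zmod_eq_zero_iff_dvd]
      simpa [nsmul_eq_mul] using hz
    have hmz : (m : ℤ) = (Nat.card H : ℤ) * q := by exact_mod_cast hq
    have hpz : (0 : ℤ) < Nat.card H := by exact_mod_cast hpos
    have hqz : (0 : ℤ) < q := by exact_mod_cast hq0
    obtain ⟨i, hi⟩ : (q : ℤ) ∣ b - a := by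
      rw [hmz] at hdvd
      exact Int.dvd_of_mul_dvd_mul_left hpz.ne' hdvd
    obtain ⟨h1, h2⟩ := hB b hb
    have hi0 : 0 ≤ i := by
      by_contra hneg
      nlinarith
    have hi1 : i ≤ Nat.card H := by
      by_contra hneg
      nlinarith
    lift i to ℕ using hi0
    refine Finset.mem_image.2 ⟨i, ?_, ?_⟩
    · rw [Finset.mem_range]
      omega
    · linarith [mul_comm (q : ℤ) i]

/-! ### Reduction modulo the diameter -/

/-- A robust form of Freiman's `3k - 4` theorem near the extremal case: if every `b ∈ B` has at
most `k` partners `b' ∈ B` with `b + b' ∉ A`, and `A` is small, then `B` lies in a short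
arithmetic progression. -/
theorem exists_arithProg_of_few_sums_outside (A B : Finset ℤ) (k r : ℕ) (hB : 2 ≤ B.card)
    (hk : ∀ b ∈ B, (B.filter (fun c => b + c ∉ A)).card ≤ k)
    (hr : r + 2 + 4 * k + A.card ≤ 3 * B.card) (hr' : B.card ≤ 2 * r) :
    ∃ (P : Finset ℤ) (h : ℕ), IsFiniteArithProg P ∧ P.card ≤ h + 1 ∧ B ⊆ P ∧
      h * r ≤ (B.card - 1) ^ 2 := by
  have hne : B.Nonempty := Finset.card_pos.1 (by omega)
  obtain ⟨lo, hlo, hlo_le⟩ := B.exists_min_image id hne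
  obtain ⟨hi, hhi, hhi_le⟩ := B.exists_max_image id hne
  simp only [id] at hlo_le hhi_le
  have hlt : lo < hi := by
    obtain ⟨x, hx, y, hy, hxy⟩ := Finset.one_lt_card.1 (show 1 < B.card by omega)
    have := hlo_le x hx
    have := hlo_le y hy
    have := hhi_le x hx
    have := hhi_le y hy
    omega
  obtain ⟨m, hm⟩ : ∃ m : ℕ, (m : ℤ) = hi - lo := ⟨(hi - lo).toNat, by omega⟩
  have hm0 : 0 < m := by omega
  have : NeZero m := ⟨hm0.ne'⟩
  let φ : ℤ → ZMod m := fun b => (b : ZMod m)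
  have hφadd : ∀ b c, φ (b + c) = φ b + φ c := fun b c => Int.cast_add b c
  have hφ : φ hi = φ lo := by
    have : φ (hi - lo) = 0 := by
      simp only [φ]
      rw [← hm]
      simp
    simpa [φ, sub_eq_zero] using this
  let X : Finset (ZMod m) := B.image φ
  have hXe : X = (B.erase hi).image φ := by
    refine Finset.Subset.antisymm ?_ (Finset.image_subset_image (Finset.erase_subset _ _))
    intro u hu
    obtain ⟨b, hb, rfl⟩ := Finset.mem_image.1 hu
    by_cases hbh : b = hi
    · subst hbh
      exact Finset.mem_image.2 ⟨lo, Finset.mem_erase.2 ⟨hlt.ne, hlo⟩, hφ.symm⟩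
    · exact Finset.mem_image_of_mem _ (Finset.mem_erase.2 ⟨hbh, hb⟩)
  -- Only `lo` and `hi` collide modulo `m`.
  have hXcard : X.card = B.card - 1 := by
    rw [hXe, Finset.card_image_of_injOn, Finset.card_erase_of_mem hhi]
    intro b hb c hc hbc
    simp only [Finset.coe_erase, Set.mem_sdiff, Finset.mem_coe, Set.mem_singleton_iff] at hb hc
    have h1 := hlo_le b hb.1
    have h2 := hlo_le c hc.1
    have h3 := lt_of_le_of_ne (hhi_le b hb.1) hb.2
    have h4 := lt_of_le_of_ne (hhi_le c hc.1) hc.2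
    have hd : (m : ℤ) ∣ c - b := (ZMod.intCast_eq_intCast_iff_dvd_sub b c m).1 hbc
    have h0 : c - b = 0 := Int.eq_zero_of_abs_lt_dvd hd (by rw [abs_lt]; omega)
    omega
  -- Sums with the endpoints account for about `2 |B|` elements of `A` but at most `|X|` residues.
  let S : Finset (ZMod m) := A.image φ
  have hgood : ∀ b ∈ B, B.card ≤ (B.filter (fun c => b + c ∈ A)).card + k := by
    intro b hb
    have := hk b hb
    have := B.card_filter_add_card_filter_not (fun c => b + c ∈ A)
    omega
  let U₀ : Finset ℤ := (B.filter (fun c => lo + c ∈ A)).image (fun c => lo + c)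
  let U₁ : Finset ℤ := (B.filter (fun c => hi + c ∈ A)).image (fun c => hi + c)
  have hU₀ : B.card ≤ U₀.card + k := by
    rw [Finset.card_image_of_injective _ (add_right_injective lo)]
    exact hgood lo hlo
  have hU₁ : B.card ≤ U₁.card + k := by
    rw [Finset.card_image_of_injective _ (add_right_injective hi)]
    exact hgood hi hhi
  -- A common element is at most `lo + hi` as a member of `U₀` and at least that as a member of
  -- `U₁`.
  have hinter : (U₀ ∩ U₁).card ≤ 1 := by
    rw [Finset.card_le_one]
    have key : ∀ a ∈ U₀ ∩ U₁, a = lo + hi := by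
      intro a ha
      obtain ⟨h1, h2⟩ := Finset.mem_inter.1 ha
      obtain ⟨c, hc, rfl⟩ := Finset.mem_image.1 h1
      obtain ⟨d, hd, hcd⟩ := Finset.mem_image.1 h2
      have := hhi_le c (Finset.mem_filter.1 hc).1
      have := hlo_le d (Finset.mem_filter.1 hd).1
      omega
    intro a ha b hb
    rw [key a ha, key b hb]
  have hUcard := Finset.card_union_add_card_inter U₀ U₁
  have hUA : U₀ ∪ U₁ ⊆ A := by
    intro a ha
    rcases Finset.mem_union.1 ha with h | h <;> obtain ⟨c, hc, rfl⟩ := Finset.mem_image.1 h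
    · exact (Finset.mem_filter.1 hc).2
    · exact (Finset.mem_filter.1 hc).2
  have hsdiff := Finset.card_sdiff_add_card_eq_card hUA
  have hSsub : S ⊆ X.image (fun x => φ lo + x) ∪ (A \ (U₀ ∪ U₁)).image φ := by
    intro u hu
    obtain ⟨a, ha, rfl⟩ := Finset.mem_image.1 hu
    by_cases haU : a ∈ U₀ ∪ U₁
    · refine Finset.mem_union_left _ ?_
      rcases Finset.mem_union.1 haU with h | h <;> obtain ⟨c, hc, rfl⟩ := Finset.mem_image.1 h
      · exact Finset.mem_image.2
          ⟨φ c, Finset.mem_image_of_mem _ (Finset.mem_filter.1 hc).1, (hφadd _ _).symm⟩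
      · exact Finset.mem_image.2
          ⟨φ c, Finset.mem_image_of_mem _ (Finset.mem_filter.1 hc).1, by rw [hφadd, hφ]⟩
    · exact Finset.mem_union_right _ (Finset.mem_image_of_mem _ (Finset.mem_sdiff.2 ⟨ha, haU⟩))
  have hScard : S.card + B.card ≤ A.card + 2 * k := by
    have h1 := (Finset.card_le_card hSsub).trans (Finset.card_union_le _ _)
    have h2 : (X.image (fun x => φ lo + x)).card ≤ X.card := Finset.card_image_le
    have h3 : ((A \ (U₀ ∪ U₁)).image φ).card ≤ (A \ (U₀ ∪ U₁)).card := Finset.card_image_le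
    omega
  have hXgood : ∀ u ∈ X, X.card ≤ (X.filter (fun v => u + v ∈ S)).card + k := by
    intro u hu
    obtain ⟨b, hb, rfl⟩ := Finset.mem_image.1 hu
    have hbad : (X.filter (fun v => ¬ φ b + v ∈ S)).card ≤ k := by
      refine le_trans ?_ (hk b hb)
      refine le_trans (Finset.card_le_card ?_)
        (Finset.card_image_le (f := φ) (s := B.filter (fun c => b + c ∉ A)))
      intro v hv
      obtain ⟨hvX, hvS⟩ := Finset.mem_filter.1 hv
      obtain ⟨c, hc, rfl⟩ := Finset.mem_image.1 hvX
      refine Finset.mem_image_of_mem _ (Finset.mem_filter.2 ⟨hc, fun hA => hvS ?_⟩)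
      rw [← hφadd]
      exact Finset.mem_image_of_mem _ hA
    have := X.card_filter_add_card_filter_not (fun v => φ b + v ∈ S)
    omega
  have hpop : ∀ u ∈ X, ∀ w ∈ X, r ≤ (X.filter (fun v => v + (u - w) ∈ X)).card := by
    intro u hu w hw
    let Vu := (X.filter (fun v => u + v ∈ S)).image (fun v => u + v)
    let Vw := (X.filter (fun v => w + v ∈ S)).image (fun v => w + v)
    have hVu : X.card ≤ Vu.card + k := by
      rw [Finset.card_image_of_injective _ (add_right_injective u)]
      exact hXgood u hu
    have hVw : X.card ≤ Vw.card + k := by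
      rw [Finset.card_image_of_injective _ (add_right_injective w)]
      exact hXgood w hw
    have hsub : Vu ∪ Vw ⊆ S := by
      intro a ha
      rcases Finset.mem_union.1 ha with h | h <;> obtain ⟨c, hc, rfl⟩ := Finset.mem_image.1 h
      · exact (Finset.mem_filter.1 hc).2
      · exact (Finset.mem_filter.1 hc).2
    have h1 := Finset.card_le_card hsub
    have h2 := Finset.card_union_add_card_inter Vu Vw
    -- A common point z = u + v = w + v' gives v + (u − w) = v'.
    have h3 : (Vu ∩ Vw).card ≤ (X.filter (fun v => v + (u - w) ∈ X)).card := by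
      refine Finset.card_le_card_of_injOn (fun z => z - u) ?_ (sub_left_injective.injOn)
      intro z hz
      obtain ⟨hz1, hz2⟩ := Finset.mem_inter.1 hz
      obtain ⟨c, hc, rfl⟩ := Finset.mem_image.1 hz1
      obtain ⟨d, hd, hdc⟩ := Finset.mem_image.1 hz2
      have hcX := (Finset.mem_filter.1 hc).1
      have hdX := (Finset.mem_filter.1 hd).1
      have e1 : u + c - u = c := by abel
      have e2 : c + (u - w) = d := by
        rw [eq_comm, ← sub_eq_zero]
        have := sub_eq_zero.2 hdc
        rw [← this]
        abel
      simp only [Finset.coe_filter, Set.mem_ofPred_eq]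
      rw [e1, e2]
      exact ⟨hcX, hdX⟩
    omega
  obtain ⟨H, hH, hHcard⟩ := exists_addSubgroup_of_popular_differences X
    (hne.image φ) r (by omega) hpop
  obtain ⟨P, hP, hPcard, hBP⟩ := exists_arithProg_of_sub_mem_addSubgroup hm0 H B lo
    (fun b hb => ⟨hlo_le b hb, by have := hhi_le b hb; omega⟩)
    (fun b hb => by
      rw [Int.cast_sub]
      exact hH _ (Finset.mem_image_of_mem φ hb) _ (Finset.mem_image_of_mem φ hlo))
  exact ⟨P, Nat.card H, hP, hPcard, hBP, by rwa [← hXcard]⟩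

/-- Few elements of `B` are involved in many pairs whose sum lies outside `A`. -/
theorem card_many_sums_outside_mul_le (A B : Finset ℤ) (k : ℕ) :
    (B.filter (fun b => k < (B.filter (fun c => b + c ∉ A)).card)).card * (k + 1) ≤
      (pairsWithSumOutside A B).card := by
  have hfib := Finset.card_eq_sum_card_fiberwise (f := Prod.fst) (s := pairsWithSumOutside A B)
    (t := B) (by
      intro p hp
      simp only [pairsWithSumOutside, Finset.coe_filter, Finset.mem_product,
        Set.mem_ofPred_eq] at hp
      exact hp.1.1)
  rw [hfib]
  refine le_trans ?_ (Finset.sum_le_sum_of_subset (Finset.filter_subset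
    (fun b => k < (B.filter (fun c => b + c ∉ A)).card) B))
  rw [← smul_eq_mul]
  refine Finset.card_nsmul_le_sum _ _ _ fun b hb => ?_
  obtain ⟨hbB, hb⟩ := Finset.mem_filter.1 hb
  refine (Nat.succ_le_of_lt hb).trans
    (Finset.card_le_card_of_injOn (fun c => (b, c)) ?_ ?_)
  · intro c hc
    simp only [Finset.coe_filter, Set.mem_ofPred_eq] at hc
    simp [pairsWithSumOutside, hbB, hc.1, hc.2]
  · intro c _ d _ hcd
    exact (Prod.ext_iff.1 hcd).2

/-! ### Numerical bounds on the progression -/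

/-- With `β` below `1` integrality gives the sharp bound of the `3k - 4` theorem. -/
theorem progression_size_bound_of_lt_one {N β : ℝ} {a n h r : ℕ} (hN : 32 ≤ N) (hβ : β < 1)
    (hβ' : 1 ≤ 16 * β) (hn : N / 2 - β / 4 ≤ n) (hn' : (n : ℝ) ≤ N / 2 + β / 2) (ha : (a : ℝ) ≤ N)
    (hr : r + 2 + a = 3 * n) (h_le : h * r ≤ (n - 1) ^ 2) :
    (h : ℝ) + 1 ≤ N / 2 + 16 * β := by
  have hn15 : 15 ≤ n := by
    have : (15 : ℝ) ≤ n := by linarith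
    exact_mod_cast this
  have han : a < 2 * n + 1 := by
    have : (a : ℝ) < 2 * n + 1 := by linarith
    exact_mod_cast this
  obtain ⟨x, rfl⟩ : ∃ x, n = x + 1 := ⟨n - 1, by omega⟩
  simp only [Nat.add_sub_cancel] at h_le
  -- Either r ≥ x and h ≤ x, or a = 2n and r = x − 1, giving h ≤ x + 1; the extra 1 is absorbed by 1
  -- ≤ 16β.
  rcases Nat.lt_or_ge a (2 * (x + 1)) with hlt | hge
  · have hrx : x ≤ r := by omega
    have hhx : h ≤ x := by
      by_contra hcon
      nlinarith [Nat.mul_le_mul_left h hrx]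
    have : (h : ℝ) ≤ x := by exact_mod_cast hhx
    push_cast at hn'
    linarith
  · have hae : a = 2 * (x + 1) := by omega
    have hrx : x = r + 1 := by omega
    have hhx : h ≤ x + 1 := by
      by_contra hcon
      subst hrx
      nlinarith
    have h1 : (h : ℝ) ≤ x + 1 := by exact_mod_cast hhx
    have h2 : (a : ℝ) = 2 * (x + 1) := by exact_mod_cast hae
    linarith

/-- The 39/4 is 3/4 + 3 + 4 + 2: three times the losses β/4 and k in |C|, then 4k, then 2 ≤ 2β. As
15 − 39/4 > 1, a larger `h` would force `h * r > x ^ 2` once N ≥ 512β. -/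
theorem progression_size_bound_of_one_le {N β : ℝ} {h : ℕ} {r x : ℝ} (hβ : 1 ≤ β)
    (hNβ : 512 * β ≤ N) (hx0 : 0 ≤ x) (hx : x ≤ N / 2 + β / 2) (hr : N / 2 - 39 / 4 * β ≤ r)
    (h_le : h * r ≤ x ^ 2) : (h : ℝ) + 1 ≤ N / 2 + 16 * β := by
  by_contra! hcon
  have hh : N / 2 + 15 * β ≤ h := by linarith
  have h1 : (N / 2 + 15 * β) * (N / 2 - 39 / 4 * β) ≤ h * r :=
    mul_le_mul hh hr (by linarith) (by positivity)
  have h2 : x ^ 2 ≤ (N / 2 + β / 2) ^ 2 := by gcongr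
  nlinarith [mul_le_mul_of_nonneg_left hNβ (by linarith : (0 : ℝ) ≤ β), mul_pos
    (by linarith : (0 : ℝ) < β) (by linarith : (0 : ℝ) < β)]

theorem corollary3p5 (s : ℤ) (K ε : ℝ) (hK : 0 < K) (hε : 0 < ε) (hε' : ε < 1 / 2 ^ 10)
    (hslack : 1 ≤ 32 * ε * (K * s))
    (A B : Finset ℤ)
    (hBlow : (1 - ε) * (K * s / 2) ≤ (B.card : ℝ))
    (hBupp : (B.card : ℝ) ≤ (1 + 2 * ε) * (K * s / 2))
    (hA : (A.card : ℝ) ≤ K * s) :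
    4 * ε ^ 2 * K ^ 2 * (s : ℝ) ^ 2 ≤ ((pairsWithSumOutside A B).card : ℝ) ∨
      ∃ P : Finset ℤ, IsFiniteArithProg P ∧
        (P.card : ℝ) ≤ K * s / 2 + 32 * ε * (K * s) ∧
        ((B \ P).card : ℝ) ≤ 8 * ε * (K * s) := by
  rw [or_iff_not_imp_left, not_le]
  intro hbad
  obtain ⟨N, hN⟩ : ∃ N, N = K * (s : ℝ) := ⟨_, rfl⟩
  obtain ⟨β, hβ⟩ : ∃ β, β = 2 * (ε * N) := ⟨_, rfl⟩
  have hbad' : ((pairsWithSumOutside A B).card : ℝ) < β ^ 2 := by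
    refine hbad.trans_eq ?_
    rw [hβ, hN]
    ring
  rw [← hN] at hslack hBlow hBupp hA ⊢
  have hβ16 : 1 ≤ 16 * β := by linarith
  have hβ0 : 0 < β := by linarith
  have hN0 : 0 < N := by
    by_contra! hneg
    nlinarith
  have hNβ : 512 * β ≤ N := by
    rw [hβ]
    norm_num at hε'
    nlinarith
  have hBlow' : N / 2 - β / 4 ≤ B.card := by linarith
  have hBupp' : (B.card : ℝ) ≤ N / 2 + β / 2 := by linarith
  have hgoal : N / 2 + 32 * ε * N = N / 2 + 16 * β := by rw [hβ]; ring
  have hgoal' : 8 * ε * N = 4 * β := by rw [hβ]; ring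
  rw [hgoal, hgoal']
  let k := ⌊β⌋₊
  have hkβ : (k : ℝ) ≤ β := Nat.floor_le hβ0.le
  have hβk : β < k + 1 := Nat.lt_floor_add_one β
  let C := B.filter (fun b => ¬ k < (B.filter (fun c => b + c ∉ A)).card)
  have hCB : C ⊆ B := Finset.filter_subset _ _
  have hsplit := B.card_filter_add_card_filter_not
    (fun b => k < (B.filter (fun c => b + c ∉ A)).card)
  -- Otherwise there would be at least (k + 1)² > β² bad pairs.
  have hdrop : (B.filter (fun b => k < (B.filter (fun c => b + c ∉ A)).card)).card ≤ k := by
    by_contra! hcon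
    have h1 := card_many_sums_outside_mul_le A B k
    have h2 : (k + 1) * (k + 1) ≤ (pairsWithSumOutside A B).card :=
      (Nat.mul_le_mul_right _ hcon).trans h1
    have h3 : ((k : ℝ) + 1) * (k + 1) ≤ (pairsWithSumOutside A B).card := by exact_mod_cast h2
    nlinarith
  have hBC : B.card ≤ C.card + k := by
    change _ + C.card = _ at hsplit
    omega
  have hCk : ∀ b ∈ C, (C.filter (fun c => b + c ∉ A)).card ≤ k := fun b hb =>
    (Finset.card_le_card (Finset.filter_subset_filter _ hCB)).trans
      (not_lt.1 (Finset.mem_filter.1 hb).2)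
  have hBCr : (B.card : ℝ) ≤ C.card + k := by exact_mod_cast hBC
  have hCBr : (C.card : ℝ) ≤ B.card := by exact_mod_cast Finset.card_le_card hCB
  have hC2 : 2 ≤ C.card := by
    have : (2 : ℝ) ≤ C.card := by linarith
    exact_mod_cast this
  have hrexists : 2 + 4 * k + A.card ≤ 3 * C.card := by
    have : (2 + 4 * k + A.card : ℝ) ≤ 3 * C.card := by linarith
    exact_mod_cast this
  obtain ⟨r, hr⟩ := Nat.exists_eq_add_of_le hrexists
  have hrr : (3 * C.card : ℝ) = 2 + 4 * k + A.card + r := by exact_mod_cast hr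
  obtain ⟨P, h, hP, hPcard, hCP, hhr⟩ := exists_arithProg_of_few_sums_outside A C k r hC2 hCk
    (by omega) (by
      have : (C.card : ℝ) ≤ 2 * r := by linarith
      exact_mod_cast this)
  refine ⟨P, hP, ?_, ?_⟩
  · have hPr : (P.card : ℝ) ≤ h + 1 := by exact_mod_cast hPcard
    refine hPr.trans ?_
    rcases lt_or_ge β 1 with hβ1 | hβ1
    · have hk0 : k = 0 := Nat.floor_eq_zero.2 hβ1
      have hCBcard : C.card = B.card :=
        le_antisymm (Finset.card_le_card hCB) (by omega)
      exact progression_size_bound_of_lt_one (a := A.card) (n := C.card) (r := r)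
        (by linarith) hβ1 hβ16 (by rw [hCBcard]; exact hBlow') (by rw [hCBcard]; exact hBupp')
        hA (by omega) hhr
    · have hhr' : (h : ℝ) * r ≤ ((C.card - 1 : ℕ) : ℝ) ^ 2 := by exact_mod_cast hhr
      have hx : ((C.card - 1 : ℕ) : ℝ) ≤ C.card := by exact_mod_cast Nat.sub_le _ _
      exact progression_size_bound_of_one_le hβ1 hNβ (by positivity) (by linarith)
        (by linarith) hhr'
  · have hsub : B \ P ⊆ B \ C := Finset.sdiff_subset_sdiff le_rfl hCP
    have h1 := Finset.card_le_card hsub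
    have h2 := Finset.card_sdiff_add_card_eq_card hCB
    have h3 : (B \ P).card ≤ k := by omega
    have h4 : ((B \ P).card : ℝ) ≤ k := by exact_mod_cast h3
    linarith
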